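/- Consider polynomials $\mathsf{P}$ with complex coefficients in the eight jet variables $f_i', f_i'', f_i''', f_i''''$ ($i=1,2$). Write $j^4 f$ for the jet at $0$ (derivatives of orders $1$ to $4$) of a germ of holomorphic map $f=(f_1,f_2)$ from $(\mathbb{C},0)$ to $\mathbb{C}^2$. The polynomial $\mathsf{P}$ is called invariant by reparametrization of weight $m\in\mathbb{N}$ if $$\mathsf{P}\big(j^4(f\circ\phi)\big)=\phi'(0)^m\,\mathsf{P}\big(j^4 f\big)$$ for every such $f$ and every germ of biholomorphism $\phi:(\mathbb{C},0)\to(\mathbb{C},0)$. Let $\mathsf{E}_{4,m}^2$ be the vector space of these polynomials and $\mathsf{E}_4^2=\bigoplus_{m\geqslant 0}\mathsf{E}_{4,m}^2$ the resulting algebra. Put $\Delta^{(\alpha),(\beta)}:=f_1^{(\alpha)}f_2^{(\beta)}-f_1^{(\beta)}f_2^{(\alpha)}$ and, for $i,j\in\{1,2\}$, $$\Lambda^3:=\Delta^{',''},\qquad \Lambda_i^5:=\Delta^{','''}f_i'-3\,\Delta^{',''}f_i'',$$ $$\Lambda_{i,j}^7:=\big(\Delta^{',''''}+4\,\Delta^{'','''}\big)f_i'f_j'-5\,\Delta^{','''}\big(f_i''f_j'+f_j''f_i'\big)+15\,\Delta^{',''}f_i''f_j'',$$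 $$M^8:=3\,\Delta^{',''''}\Delta^{',''}+12\,\Delta^{'','''}\Delta^{',''}-5\,\big(\Delta^{','''}\big)^2.$$ Proposition. For all polynomials $\mathcal{Q},\mathcal{R},\mathcal{S},\mathcal{T},\mathcal{U},\mathcal{V}$ in five variables with complex coefficients, the polynomial $$\mathcal{Q}+\Lambda^3\,\mathcal{R}+\Lambda_1^5\,\mathcal{S}+\Lambda_2^5\,\mathcal{T}+\Lambda_{1,2}^7\,\mathcal{U}+\Lambda^3\Lambda_{1,2}^7\,\mathcal{V},$$ in which each of $\mathcal{Q},\dots,\mathcal{V}$ is evaluated at $\big(f_1',f_2',\Lambda_{1,1}^7,\Lambda_{2,2}^7,M^8\big)$, belongs to $\mathsf{E}_4^2$; and every $\mathsf{P}\in\mathsf{E}_4^2$ can be written in this form for exactly one sextuple $(\mathcal{Q},\mathcal{R},\mathcal{S},\mathcal{T},\mathcal{U},\mathcal{V})$. -/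

import Mathlib

open MvPolynomial

namespace DemaillySemple

/-- Polynomials in the jet variables of `n` functions up to order `κ`: the variable `X (i, k)`
stands for the derivative of order `k + 1` of the `i`-th function (the functions themselves, that
is their derivatives of order `0`, do not occur). -/
abbrev JetPoly (κ n : ℕ) : Type := MvPolynomial (Fin n × Fin κ) ℂ

/-- The `κ`-jet at the origin of an `n`-tuple of functions of one complex variable. -/
noncomputable def jet (κ : ℕ) {n : ℕ} (f : Fin n → ℂ → ℂ) : Fin n × Fin κ → ℂ :=
  fun p => iteratedDeriv ((p.2 : ℕ) + 1) (f p.1) 0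

/-- `P (j^κ (f ∘ φ)) = (φ')^m P (j^κ f)` at the origin, for every germ `f` of holomorphic map
`(ℂ, 0) → ℂⁿ` and every germ `φ` of biholomorphism `(ℂ, 0) → (ℂ, 0)`. -/
def IsInvariantOfWeight {κ n : ℕ} (m : ℕ) (P : JetPoly κ n) : Prop :=
  ∀ (f : Fin n → ℂ → ℂ) (φ : ℂ → ℂ), (∀ i, AnalyticAt ℂ (f i) 0) →
    AnalyticAt ℂ φ 0 → φ 0 = 0 → deriv φ 0 ≠ 0 →
      eval (jet κ fun i => f i ∘ φ) P = deriv φ 0 ^ m * eval (jet κ f) P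

/-- The vector space of the jet polynomials of weight `m` invariant by reparametrization. -/
noncomputable def invariantsOfWeight (κ n m : ℕ) : Submodule ℂ (JetPoly κ n) where
  carrier := {P | IsInvariantOfWeight m P}
  zero_mem' := by
    intro f φ _ _ _ _
    simp
  add_mem' := by
    intro P Q hP hQ f φ hf hφ h0 h1
    rw [map_add, map_add, hP f φ hf hφ h0 h1, hQ f φ hf hφ h0 h1, mul_add]
  smul_mem' := by
    intro c P hP f φ hf hφ h0 h1
    rw [smul_eval, smul_eval, hP f φ hf hφ h0 h1, mul_left_comm]

theorem mul_mem_invariantsOfWeight {κ n m₁ m₂ : ℕ} {P Q : JetPoly κ n}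
    (hP : P ∈ invariantsOfWeight κ n m₁) (hQ : Q ∈ invariantsOfWeight κ n m₂) :
    P * Q ∈ invariantsOfWeight κ n (m₁ + m₂) := by
  intro f φ hf hφ h0 h1
  rw [map_mul, map_mul, hP f φ hf hφ h0 h1, hQ f φ hf hφ h0 h1, pow_add]
  ring

/-- The algebra of jet polynomials of order `κ` in dimension `n` invariant by reparametrization:
the sum over all weights `m` of the spaces of invariants of weight `m`. -/
noncomputable def invariantAlgebra (κ n : ℕ) : Subalgebra ℂ (JetPoly κ n) :=
  (⨆ m : ℕ, invariantsOfWeight κ n m).toSubalgebra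
    (by
      refine Submodule.mem_iSup_of_mem 0 ?_
      intro f φ _ _ _ _
      simp)
    (by
      intro P Q hP hQ
      induction hP using Submodule.iSup_induction' with
      | mem i P hP =>
        induction hQ using Submodule.iSup_induction' with
        | mem j Q hQ =>
          exact Submodule.mem_iSup_of_mem (i + j) (mul_mem_invariantsOfWeight hP hQ)
        | zero => simp
        | add Q₁ Q₂ _ _ h₁ h₂ => rw [mul_add]; exact Submodule.add_mem _ h₁ h₂
      | zero => simp
      | add P₁ P₂ _ _ h₁ h₂ => rw [add_mul]; exact Submodule.add_mem _ h₁ h₂)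

/-! The basic invariants in dimension two for jets of order four. The index `i : Fin 2` names the
function `f₁` or `f₂`. -/

/-- The first derivative `f_i'`. -/
noncomputable def d1 (i : Fin 2) : JetPoly 4 2 := X (i, 0)

/-- The second derivative `f_i''`. -/
noncomputable def d2 (i : Fin 2) : JetPoly 4 2 := X (i, 1)

/-- The third derivative `f_i'''`. -/
noncomputable def d3 (i : Fin 2) : JetPoly 4 2 := X (i, 2)

/-- The fourth derivative `f_i''''`. -/
noncomputable def d4 (i : Fin 2) : JetPoly 4 2 := X (i, 3)

/-- The `2 × 2` determinant with rows `(a₁, a₂)` and `(b₁, b₂)`; `Δ d1 d3`, for instance, is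
`f₁' f₂''' - f₁''' f₂'`. -/
noncomputable def Δ (a b : Fin 2 → JetPoly 4 2) : JetPoly 4 2 :=
  Matrix.det !![a 0, a 1; b 0, b 1]

/-- The invariant `Λ³`. -/
noncomputable def Λ3 : JetPoly 4 2 := Δ d1 d2

/-- The invariants `Λ⁵_i`. -/
noncomputable def Λ5 (i : Fin 2) : JetPoly 4 2 := Δ d1 d3 * d1 i - 3 * Δ d1 d2 * d2 i

/-- The invariants `Λ⁷_{i,j}`. -/
noncomputable def Λ7 (i j : Fin 2) : JetPoly 4 2 :=
  (Δ d1 d4 + 4 * Δ d2 d3) * (d1 i * d1 j) - 5 * Δ d1 d3 * (d2 i * d1 j + d2 j * d1 i)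
    + 15 * Δ d1 d2 * (d2 i * d2 j)

/-- The invariant `M⁸`. -/
noncomputable def M8 : JetPoly 4 2 :=
  3 * Δ d1 d4 * Δ d1 d2 + 12 * Δ d2 d3 * Δ d1 d2 - 5 * Δ d1 d3 ^ 2

/-- The substitution `A (f₁', f₂', Λ⁷_{1,1}, Λ⁷_{2,2}, M⁸)` in a polynomial `A` of five
variables. -/
noncomputable def subst (A : MvPolynomial (Fin 5) ℂ) : JetPoly 4 2 :=
  aeval ![d1 0, d1 1, Λ7 0 0, Λ7 1 1, M8] A

end DemaillySemple

namespace DemaillySemple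

/-! Where `f₁' ≠ 0`, a reparametrization tangent to the identity makes `f₁` linear. The derivatives
of `f₂` then become `f₂'`, `Λ³/f₁'`, `Λ⁵₁/f₁'²`, `Λ⁷₁₁/f₁'³`, so an invariant times a power of `f₁'`
is a polynomial in `f₁'`, `f₂'`, `Λ³`, `Λ⁵₁`, `Λ⁷₁₁`. Quadratic syzygies show that the span of the
six generators is stable under multiplication by these five (`Λ3_mul_mem`, `Λ5_mul_mem`), hence
contains that product.

The power of `f₁'` is removed by `X_dvd_of_comb`: a combination vanishing on `f₁' = 0` has all six
coefficients divisible by the first variable. Indeed, on jets with `f₁' = 0` and `f₂` linear, put `u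
= f₁''`, `v = f₁'''`: up to scalars and powers of `f₂'`, the generators become `1, u, u², v, uv,
u²v`. For generic values of the five arguments, `u` runs over three cube roots and `v` over two
opposite square roots, so the six coefficients vanish.

The same divisibility, iterated, gives uniqueness. -/

/-! ### Reparametrization as an action on jets -/

theorem iteratedDeriv_succ_comp {g φ : ℂ → ℂ} {z : ℂ} (hg : AnalyticAt ℂ g (φ z))
    (hφ : AnalyticAt ℂ φ z) (n : ℕ) :
    iteratedDeriv (n + 1) (g ∘ φ) z = ∑ i ∈ Finset.range (n + 1), (n.choose i : ℂ) *
      iteratedDeriv i (deriv g ∘ φ) z * iteratedDeriv (n - i + 1) φ z := by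
  have h : deriv (g ∘ φ) =ᶠ[nhds z] (deriv g ∘ φ) * deriv φ := by
    filter_upwards [hφ.eventually_analyticAt,
      hφ.continuousAt.eventually hg.eventually_analyticAt] with w hw hgw
    exact deriv_comp w hgw.differentiableAt hw.differentiableAt
  rw [iteratedDeriv_succ', h.iteratedDeriv_eq,
    iteratedDeriv_mul (hg.deriv.comp hφ).contDiffAt hφ.deriv.contDiffAt]
  simp only [iteratedDeriv_succ']

/-- The action on jets of order four of a reparametrization with jet `c`. -/
noncomputable def reparam (c : Fin 4 → ℂ) (x : Fin 2 × Fin 4 → ℂ) : Fin 2 × Fin 4 → ℂ :=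
  fun p => ![x (p.1, 0) * c 0,
    x (p.1, 1) * c 0 ^ 2 + x (p.1, 0) * c 1,
    x (p.1, 2) * c 0 ^ 3 + 3 * x (p.1, 1) * c 0 * c 1 + x (p.1, 0) * c 2,
    x (p.1, 3) * c 0 ^ 4 + 6 * x (p.1, 2) * c 0 ^ 2 * c 1
      + x (p.1, 1) * (3 * c 1 ^ 2 + 4 * c 0 * c 2) + x (p.1, 0) * c 3] p.2

theorem jet_comp {f : Fin 2 → ℂ → ℂ} {φ : ℂ → ℂ} (hf : ∀ i, AnalyticAt ℂ (f i) 0)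
    (hφ : AnalyticAt ℂ φ 0) (h0 : φ 0 = 0) :
    jet 4 (fun i => f i ∘ φ) = reparam (fun k => iteratedDeriv (k + 1) φ 0) (jet 4 f) := by
  have key : ∀ {g : ℂ → ℂ}, AnalyticAt ℂ g 0 → ∀ n, iteratedDeriv (n + 1) (g ∘ φ) 0 =
      ∑ i ∈ Finset.range (n + 1), (n.choose i : ℂ) *
        iteratedDeriv i (deriv g ∘ φ) 0 * iteratedDeriv (n - i + 1) φ 0 :=
    fun hg n => iteratedDeriv_succ_comp (by rwa [h0]) hφ n
  ext ⟨i, k⟩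
  have h1 := (hf i).deriv
  have h2 := h1.deriv
  have h3 := h2.deriv
  fin_cases k <;>
  · simp [jet, reparam, key (hf i), key h1, key h2, key h3, Finset.sum_range_succ,
      iteratedDeriv_succ', iteratedDeriv_zero, h0, Nat.choose]
    try ring

theorem exists_analyticAt_iteratedDeriv_eq {κ : ℕ} (c : Fin κ → ℂ) :
    ∃ g : ℂ → ℂ, AnalyticAt ℂ g 0 ∧ g 0 = 0 ∧ ∀ k : Fin κ, iteratedDeriv (k + 1) g 0 = c k := by
  refine ⟨fun z => ∑ k : Fin κ, c k / ((k : ℕ) + 1).factorial * z ^ ((k : ℕ) + 1), ?_, ?_, ?_⟩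
  · fun_prop
  · simp
  · intro k
    rw [iteratedDeriv_fun_sum (fun i _ => by fun_prop)]
    simp only [iteratedDeriv_const_mul_field, iteratedDeriv_fun_pow_zero]
    rw [Finset.sum_eq_single k]
    · have : ((((k : ℕ) + 1).factorial : ℕ) : ℂ) ≠ 0 := by exact_mod_cast Nat.factorial_ne_zero _
      simp [this]
    · intro j _ hj
      have : (k : ℕ) ≠ j := fun h => hj (Fin.ext h.symm)
      simp [this]
    · simp

/-- Every finite jet is that of a polynomial germ, so invariance becomes a purely algebraic
condition. -/
theorem mem_invariantsOfWeight_iff {m : ℕ} {P : JetPoly 4 2} :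
    P ∈ invariantsOfWeight 4 2 m ↔
      ∀ c x, c 0 ≠ 0 → eval (reparam c x) P = c 0 ^ m * eval x P := by
  constructor
  · intro hP c x hc
    obtain ⟨φ, hφ, hφ0, hφc⟩ := exists_analyticAt_iteratedDeriv_eq c
    choose f hf _ hfx using fun i => exists_analyticAt_iteratedDeriv_eq fun k : Fin 4 => x (i, k)
    have hd : deriv φ 0 = c 0 := by simpa [iteratedDeriv_one] using hφc 0
    have hx : jet 4 f = x := funext fun p => hfx p.1 p.2
    have h := hP f φ hf hφ hφ0 (by rwa [hd])
    rwa [jet_comp hf hφ hφ0, funext hφc, hx, hd] at h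
  · intro h f φ hf hφ hφ0 hφ1
    rw [jet_comp hf hφ hφ0, h _ _ (by simpa [iteratedDeriv_one] using hφ1)]
    simp [iteratedDeriv_one]

/-! ### Syzygies between the basic invariants -/

theorem Δ_eq (p q : Fin 2 → JetPoly 4 2) : Δ p q = p 0 * q 1 - p 1 * q 0 := by
  simp [Δ, Matrix.det_fin_two_of]

theorem three_mul_Λ3_sq : 3 * Λ3 ^ 2 = d1 1 * Λ5 0 - d1 0 * Λ5 1 := by
  simp only [Λ3, Λ5, Δ_eq]; ring

theorem five_mul_Λ3_mul_Λ5 (i : Fin 2) :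
    5 * (Λ3 * Λ5 i) = d1 1 * Λ7 0 i - d1 0 * Λ7 1 i := by
  simp only [Λ3, Λ5, Λ7, Δ_eq]; ring

theorem five_mul_Λ5_mul_Λ5 (i j : Fin 2) :
    5 * (Λ5 i * Λ5 j) = 3 * (Λ3 * Λ7 i j) - d1 i * d1 j * M8 := by
  simp only [Λ3, Λ5, Λ7, M8, Δ_eq]; ring

theorem Λ5_mul_Λ7_sub (i : Fin 2) : Λ5 0 * Λ7 i 1 - Λ5 1 * Λ7 i 0 = d1 i * Λ3 * M8 := by
  simp only [Λ3, Λ5, Λ7, M8, Δ_eq]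
  fin_cases i <;> · simp only [Fin.zero_eta, Fin.mk_one]; ring

theorem Λ7_mul_Λ7_sub : Λ7 0 0 * Λ7 1 1 - Λ7 0 1 ^ 2 = 5 * Λ3 ^ 2 * M8 := by
  simp only [Λ3, Λ7, M8, Δ_eq]; ring

theorem Λ7_comm (i j : Fin 2) : Λ7 i j = Λ7 j i := by
  simp only [Λ7]; ring

/-! ### The module spanned by the six generators -/

/-- The combination of the six module generators over the algebra generated by
`f₁', f₂', Λ⁷₁₁, Λ⁷₂₂, M⁸`, with coefficients `A`. -/
noncomputable def comb (A : Fin 6 → MvPolynomial (Fin 5) ℂ) : JetPoly 4 2 :=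
  subst (A 0) + Λ3 * subst (A 1) + Λ5 0 * subst (A 2) + Λ5 1 * subst (A 3)
    + Λ7 0 1 * subst (A 4) + Λ3 * Λ7 0 1 * subst (A 5)

theorem subst_add (A B : MvPolynomial (Fin 5) ℂ) : subst (A + B) = subst A + subst B :=
  map_add _ A B

theorem subst_sub (A B : MvPolynomial (Fin 5) ℂ) : subst (A - B) = subst A - subst B :=
  map_sub _ A B

theorem subst_mul (A B : MvPolynomial (Fin 5) ℂ) : subst (A * B) = subst A * subst B :=
  map_mul _ A B

theorem subst_C (c : ℂ) : subst (C c) = C c := by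
  simp [subst, algebraMap_eq]

theorem subst_X (i : Fin 5) : subst (X i) = ![d1 0, d1 1, Λ7 0 0, Λ7 1 1, M8] i := by
  simp [subst]

theorem comb_add (A B : Fin 6 → MvPolynomial (Fin 5) ℂ) : comb (A + B) = comb A + comb B := by
  simp only [comb, Pi.add_apply, subst_add]; ring

theorem comb_sub (A B : Fin 6 → MvPolynomial (Fin 5) ℂ) : comb (A - B) = comb A - comb B := by
  simp only [comb, Pi.sub_apply, subst_sub]; ring

theorem comb_smul (B : MvPolynomial (Fin 5) ℂ) (A : Fin 6 → MvPolynomial (Fin 5) ℂ) :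
    comb (B • A) = subst B * comb A := by
  simp only [comb, Pi.smul_apply, smul_eq_mul, subst_mul]; ring

/-- The span of the six module generators. -/
def combSpan : AddSubgroup (JetPoly 4 2) where
  carrier := Set.range comb
  zero_mem' := ⟨0, by simp [comb, subst]⟩
  add_mem' := by
    rintro _ _ ⟨A, rfl⟩ ⟨B, rfl⟩
    exact ⟨A + B, comb_add A B⟩
  neg_mem' := by
    rintro _ ⟨A, rfl⟩
    exact ⟨-A, by simp only [comb, Pi.neg_apply, subst, map_neg]; ring⟩

theorem subst_mul_mem {w : JetPoly 4 2} (hw : w ∈ combSpan) (B : MvPolynomial (Fin 5) ℂ) :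
    subst B * w ∈ combSpan := by
  obtain ⟨A, rfl⟩ := hw
  exact ⟨B • A, comb_smul B A⟩

theorem C_mem (c : ℂ) : C c ∈ combSpan :=
  ⟨Pi.single 0 (C c), by simp [comb, subst_C]; simp [subst]⟩

theorem d1_mul_mem {w : JetPoly 4 2} (hw : w ∈ combSpan) (i : Fin 2) : d1 i * w ∈ combSpan := by
  fin_cases i
  · simpa [subst_X] using subst_mul_mem hw (X 0)
  · simpa [subst_X] using subst_mul_mem hw (X 1)

theorem Λ7_mul_mem {w : JetPoly 4 2} (hw : w ∈ combSpan) : Λ7 0 0 * w ∈ combSpan := by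
  simpa [subst_X] using subst_mul_mem hw (X 2)

theorem C_third : (C (1 / 3) : JetPoly 4 2) * 3 = 1 := by
  rw [show (3 : JetPoly 4 2) = C 3 from rfl, ← C_mul]; norm_num

theorem C_fifth : (C (1 / 5) : JetPoly 4 2) * 5 = 1 := by
  rw [show (5 : JetPoly 4 2) = C 5 from rfl, ← C_mul]; norm_num

theorem Λ3_sq : Λ3 ^ 2 = C (1 / 3) * (d1 1 * Λ5 0 - d1 0 * Λ5 1) := by
  linear_combination C (1 / 3) * three_mul_Λ3_sq - Λ3 ^ 2 * C_third

theorem Λ3_mul_Λ5 (i : Fin 2) :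
    Λ3 * Λ5 i = C (1 / 5) * (d1 1 * Λ7 0 i - d1 0 * Λ7 1 i) := by
  linear_combination C (1 / 5) * five_mul_Λ3_mul_Λ5 i - Λ3 * Λ5 i * C_fifth

theorem Λ5_mul_Λ5 (i j : Fin 2) :
    Λ5 i * Λ5 j = C (1 / 5) * (3 * (Λ3 * Λ7 i j) - d1 i * d1 j * M8) := by
  linear_combination C (1 / 5) * five_mul_Λ5_mul_Λ5 i j - Λ5 i * Λ5 j * C_fifth

theorem Λ3_mul_mem {w : JetPoly 4 2} (hw : w ∈ combSpan) : Λ3 * w ∈ combSpan := by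
  obtain ⟨A, rfl⟩ := hw
  -- Each product of `Λ³` with a generator is rewritten by the syzygies; the entries collect the
  -- resulting coefficients.
  refine ⟨![C (1 / 5) * (X 1 * X 2 * A 2 - X 0 * X 3 * A 3),
    A 0 + C (1 / 3) * (X 0 * X 1 * X 4 + X 0 * X 1 * X 4) * A 5,
    C (1 / 3) * (X 1 * A 1 - X 0 * X 3 * A 5),
    C (1 / 3) * (X 1 * X 2 * A 5 - X 0 * A 1),
    C (1 / 5) * (X 1 * A 3 - X 0 * A 2),
    A 4], ?_⟩
  simp [comb, subst_add, subst_sub, subst_mul, subst_C, subst_X, -one_div]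
  have h := Λ7_comm 1 0
  have e0 := Λ3_mul_Λ5 0
  have e1 := Λ3_mul_Λ5 1
  have f0 := Λ5_mul_Λ7_sub 0
  have f1 := Λ5_mul_Λ7_sub 1
  rw [h] at e0 f1
  linear_combination -(subst (A 1) + Λ7 0 1 * subst (A 5)) * Λ3_sq - subst (A 2) * e0
    - subst (A 3) * e1 - C (1 / 3) * subst (A 5) * (d1 1 * f0 + d1 0 * f1)

theorem Λ5_mul_mem {w : JetPoly 4 2} (hw : w ∈ combSpan) : Λ5 0 * w ∈ combSpan := by
  obtain ⟨A, rfl⟩ := hw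
  refine ⟨![C (1 / 5) * (X 1 * X 2 * A 1 - X 0 * X 0 * X 4 * A 2 - X 0 * X 1 * X 4 * A 3
      - X 0 * X 2 * X 3 * A 5),
    C (1 / 5) * (C 3 * X 2 * A 2) + X 0 * X 4 * A 4,
    A 0 + C (1 / 3) * (X 0 * X 1 * X 4 * A 5),
    X 2 * A 4 - C (1 / 3) * (X 0 * X 0 * X 4 * A 5),
    C (1 / 5) * (X 1 * X 2 * A 5 - X 0 * A 1),
    C (1 / 5) * (C 3 * A 3)], ?_⟩
  simp [comb, subst_add, subst_sub, subst_mul, subst_C, subst_X, -one_div]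
  rw [show (C 3 : JetPoly 4 2) = 3 from rfl]
  have e0 := Λ3_mul_Λ5 0
  rw [Λ7_comm 1 0] at e0
  linear_combination -(subst (A 1) + Λ7 0 1 * subst (A 5)) * e0
    - subst (A 2) * Λ5_mul_Λ5 0 0 - subst (A 3) * Λ5_mul_Λ5 0 1
    - subst (A 4) * Λ5_mul_Λ7_sub 0
    -- The product with `Λ³Λ⁷₁₂` produces `(Λ⁷₁₂)²`, hence a term in `(Λ³)²` to be reduced again.
    - C (1 / 5) * d1 0 * subst (A 5) * Λ7_mul_Λ7_sub
    - d1 0 * M8 * subst (A 5) * Λ3_sq - d1 0 * M8 * subst (A 5) * Λ3 ^ 2 * C_fifth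

/-! ### Restriction to `f₁' = 0` and uniqueness -/

theorem eval_aeval {σ τ : Type*} (x : τ → ℂ) (g : σ → MvPolynomial τ ℂ)
    (P : MvPolynomial σ ℂ) : eval x (aeval g P) = eval (fun j => eval x (g j)) P := by
  induction P using MvPolynomial.induction_on with
  | C c => simp [algebraMap_eq]
  | add p q hp hq => rw [map_add, map_add, map_add, hp, hq]
  | mul_X p j hp => rw [map_mul, map_mul, map_mul, hp, aeval_X, eval_X]

/-- A polynomial is congruent modulo `X i` to its value at `X i = 0`, which vanishes as a function,
hence as a polynomial. -/
theorem X_dvd_of_eval_eq_zero {σ : Type*} {i : σ} {P : MvPolynomial σ ℂ}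
    (h : ∀ x : σ → ℂ, x i = 0 → eval x P = 0) : X i ∣ P := by
  classical
  have hsub : ∀ Q : MvPolynomial σ ℂ, X i ∣ Q - aeval (Function.update X i 0) Q := by
    intro Q
    induction Q using MvPolynomial.induction_on with
    | C c => simp [algebraMap_eq]
    | add p q hp hq => rw [map_add, add_sub_add_comm]; exact dvd_add hp hq
    | mul_X p j hp =>
      rw [map_mul, aeval_X]
      have hj : (X i : MvPolynomial σ ℂ) ∣ X j - Function.update X i 0 j := by
        by_cases hij : j = i
        · subst hij; simp
        · simp [hij]
      convert dvd_add (hp.mul_right (X j))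
        (hj.mul_left (aeval (Function.update X i 0 : σ → MvPolynomial σ ℂ) p)) using 1
      ring
  have h0 : aeval (Function.update X i 0 : σ → MvPolynomial σ ℂ) P = 0 := by
    refine MvPolynomial.funext fun x => ?_
    rw [map_zero, eval_aeval]
    exact h _ (by simp)
  have h1 := hsub P
  rwa [h0, sub_zero] at h1

/-- Fourier inversion over the three cube roots `u`, `w u`, `w² u` isolates each term. -/
theorem eq_zero_of_forall_cube_eq {p q r t : ℂ} (ht : t ≠ 0)
    (h : ∀ u, u ^ 3 = t → p + q * u + r * u ^ 2 = 0) : p = 0 ∧ q = 0 ∧ r = 0 := by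
  obtain ⟨u, hu⟩ := IsAlgClosed.exists_pow_nat_eq t (n := 3) (by norm_num)
  obtain ⟨d, hd⟩ := IsAlgClosed.exists_pow_nat_eq (-3 : ℂ) (n := 2) (by norm_num)
  have hu0 : u ≠ 0 := by rintro rfl; exact ht (by rw [← hu]; simp)
  obtain ⟨w, hw⟩ : ∃ w : ℂ, w ^ 2 + w + 1 = 0 := ⟨(-1 + d) / 2, by linear_combination hd / 4⟩
  have hw3 : w ^ 3 = 1 := by linear_combination (w - 1) * hw
  have h1 := h u hu
  have h2 := h (w * u) (by linear_combination u ^ 3 * hw3 + hu)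
  have h3 := h (w ^ 2 * u) (by linear_combination u ^ 3 * (w ^ 3 + 1) * hw3 + hu)
  have hp : p = 0 := by
    linear_combination (h1 + h2 + h3) / 3 - (q * u + r * u ^ 2) / 3 * hw
      - r * u ^ 2 * w / 3 * hw3
  have hq : q * u = 0 := by
    linear_combination (h1 + w ^ 2 * h2 + w * h3) / 3 - (p + r * u ^ 2) / 3 * hw
      - (2 * q * u + r * u ^ 2 * (w + w ^ 2)) / 3 * hw3
  have hq := (mul_eq_zero.1 hq).resolve_right hu0
  refine ⟨hp, hq, ?_⟩
  have hr : r * u ^ 2 = 0 := by linear_combination h1 - hp - u * hq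
  exact (mul_eq_zero.1 hr).resolve_right (pow_ne_zero 2 hu0)

theorem eval_subst (x : Fin 2 × Fin 4 → ℂ) (A : MvPolynomial (Fin 5) ℂ) :
    eval x (subst A) = eval ![eval x (d1 0), eval x (d1 1), eval x (Λ7 0 0), eval x (Λ7 1 1),
      eval x M8] A := by
  rw [subst, eval_aeval]
  congr 2
  ext i
  fin_cases i <;> rfl

theorem eval_comb_of_d1_zero (A : Fin 6 → MvPolynomial (Fin 5) ℂ) (b u v w : ℂ) :
    eval (fun p => ![![0, u, v, w], ![b, 0, 0, 0]] p.1 p.2) (comb A) =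
      let y : Fin 5 → ℂ := ![0, b, -15 * b * u ^ 3, -b ^ 3 * w,
        3 * b ^ 2 * u * w - 5 * b ^ 2 * v ^ 2]
      eval y (A 0) - b * u * eval y (A 1) + 3 * b * u ^ 2 * eval y (A 2) - b ^ 2 * v * eval y (A 3)
        + 5 * b ^ 2 * u * v * eval y (A 4) - 5 * b ^ 3 * u ^ 2 * v * eval y (A 5) := by
  extract_lets y
  have hs : ∀ B, eval (fun p => ![![0, u, v, w], ![b, 0, 0, 0]] p.1 p.2) (subst B) =
      eval y B := by
    intro B
    rw [eval_subst]
    congr 2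
    ext i
    fin_cases i <;> simp [y, d1, d2, d3, d4, Λ7, M8, Δ_eq] <;> ring
  simp only [comb, map_add, map_mul, hs]
  simp [d1, d2, d3, d4, Λ3, Λ5, Λ7, Δ_eq]
  ring

theorem eval_eq_zero_of_comb {A : Fin 6 → MvPolynomial (Fin 5) ℂ}
    (hA : ∀ x : Fin 2 × Fin 4 → ℂ, x (0, 0) = 0 → eval x (comb A) = 0) {b s N M : ℂ}
    (hb : b ≠ 0) (hs : s ≠ 0) (hG : 9 * s * N ^ 3 - 5 * b ^ 4 * M ^ 3 ≠ 0) (j : Fin 6) :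
    eval ![0, b, s, N, M] (A j) = 0 := by
  set g : Fin 6 → ℂ := fun j => eval ![0, b, s, N, M] (A j) with hg
  have key : ∀ u, u ^ 3 = -s / (15 * b) →
      g 0 + (-b * g 1) * u + (3 * b * g 2) * u ^ 2 = 0 ∧
      g 3 + (-5 * g 4) * u + (5 * b * g 5) * u ^ 2 = 0 := by
    intro u hu
    -- With `w = -N / b³` imposed by `Λ⁷₂₂ = N`, this is the equation `M⁸ = M` solved for `v²`.
    obtain ⟨v, hv⟩ := IsAlgClosed.exists_pow_nat_eq (-(3 * u * N + b * M) / (5 * b ^ 3)) (n := 2)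
      (by norm_num)
    have hu' : 15 * b * u ^ 3 = -s := by rw [hu]; field_simp
    have hv' : 5 * b ^ 3 * v ^ 2 = -(3 * u * N + b * M) := by rw [hv]; field_simp
    -- If `v = 0` then `bM = -3uN`; cubing eliminates `u` and contradicts `hG`.
    have hv0 : v ≠ 0 := by
      rintro rfl
      have e : b * M = -3 * u * N := by linear_combination hv'
      refine hG ?_
      have : b * (9 * s * N ^ 3 - 5 * b ^ 4 * M ^ 3) = 0 := by
        have e3 : b ^ 3 * M ^ 3 = -27 * u ^ 3 * N ^ 3 := by
          rw [← mul_pow, e]; ring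
        linear_combination -5 * b ^ 2 * e3 + 9 * b * N ^ 3 * hu'
      exact (mul_eq_zero.1 this).resolve_left hb
    have hy : ∀ v', v' ^ 2 = v ^ 2 → (![0, b, -15 * b * u ^ 3, -b ^ 3 * (-N / b ^ 3),
        3 * b ^ 2 * u * (-N / b ^ 3) - 5 * b ^ 2 * v' ^ 2] : Fin 5 → ℂ) = ![0, b, s, N, M] := by
      intro v' hv2
      have e1 : -15 * b * u ^ 3 = s := by linear_combination -hu'
      have e2 : -b ^ 3 * (-N / b ^ 3) = N := by field_simp
      have e3 : 3 * b ^ 2 * u * (-N / b ^ 3) - 5 * b ^ 2 * v' ^ 2 = M := by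
        rw [hv2]
        field_simp
        linear_combination -hv'
      rw [e1, e2, e3]
    -- The jets with `v` and `-v` give the same five arguments, which separates the parts even and
    -- odd in `v`.
    have h1 := hA (fun p => ![![0, u, v, -N / b ^ 3], ![b, 0, 0, 0]] p.1 p.2) (by simp)
    have h2 := hA (fun p => ![![0, u, -v, -N / b ^ 3], ![b, 0, 0, 0]] p.1 p.2) (by simp)
    rw [eval_comb_of_d1_zero] at h1 h2
    simp only [hy v rfl, hy (-v) (by ring)] at h1 h2
    constructor
    · simp only [hg]
      linear_combination (h1 + h2) / 2
    · have : b ^ 2 * v * (g 3 + (-5 * g 4) * u + (5 * b * g 5) * u ^ 2) = 0 := by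
        simp only [hg]
        linear_combination (h2 - h1) / 2
      exact (mul_eq_zero.1 this).resolve_left (mul_ne_zero (pow_ne_zero 2 hb) hv0)
  have ht : -s / (15 * b) ≠ 0 := by
    exact div_ne_zero (neg_ne_zero.2 hs) (mul_ne_zero (by norm_num) hb)
  obtain ⟨e0, e1, e2⟩ := eq_zero_of_forall_cube_eq ht fun u hu => (key u hu).1
  obtain ⟨e3, e4, e5⟩ := eq_zero_of_forall_cube_eq ht fun u hu => (key u hu).2
  change g j = 0
  fin_cases j <;> simp_all

theorem X_dvd_of_comb {A : Fin 6 → MvPolynomial (Fin 5) ℂ}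
    (hA : ∀ x : Fin 2 × Fin 4 → ℂ, x (0, 0) = 0 → eval x (comb A) = 0) (j : Fin 6) :
    X 0 ∣ A j := by
  -- `G` cuts out the non-generic arguments; it is prime to `X 0`.
  let G : MvPolynomial (Fin 5) ℂ := X 1 * X 2 * (C 9 * X 2 * X 3 ^ 3 - C 5 * X 1 ^ 4 * X 4 ^ 3)
  have hdvd : X 0 ∣ A j * G := by
    refine X_dvd_of_eval_eq_zero fun x hx => ?_
    rw [map_mul]
    by_cases hG : eval x G = 0
    · rw [hG, mul_zero]
    · simp only [G, map_mul, map_sub, map_pow, eval_X, eval_C, mul_eq_zero, not_or] at hG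
      have hx' : x = ![0, x 1, x 2, x 3, x 4] := by
        ext i
        fin_cases i <;> simp [hx]
      rw [hx', eval_eq_zero_of_comb hA hG.1.1 hG.1.2 hG.2, zero_mul]
  refine (X_prime.dvd_or_dvd hdvd).resolve_right ?_
  rintro ⟨B, hB⟩
  have := congrArg (eval (![0, 1, 1, 1, 1] : Fin 5 → ℂ)) hB
  simp [G] at this
  norm_num at this

theorem exists_comb_eq_d1_mul {A : Fin 6 → MvPolynomial (Fin 5) ℂ}
    (hA : ∀ x : Fin 2 × Fin 4 → ℂ, x (0, 0) = 0 → eval x (comb A) = 0) :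
    ∃ B : Fin 6 → MvPolynomial (Fin 5) ℂ, A = (X 0 : MvPolynomial (Fin 5) ℂ) • B ∧
      comb A = d1 0 * comb B := by
  choose B hB using X_dvd_of_comb hA
  have h : A = (X 0 : MvPolynomial (Fin 5) ℂ) • B := funext hB
  exact ⟨B, h, by rw [h, comb_smul, subst_X]; rfl⟩

theorem d1_ne_zero (i : Fin 2) : d1 i ≠ 0 := X_ne_zero _

theorem mem_combSpan_of_d1_mul_mem {P : JetPoly 4 2} (h : d1 0 * P ∈ combSpan) :
    P ∈ combSpan := by
  obtain ⟨A, hA⟩ := h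
  obtain ⟨B, -, hB⟩ := exists_comb_eq_d1_mul (A := A) fun x hx => by
    rw [hA, map_mul, d1, eval_X, hx, zero_mul]
  exact ⟨B, mul_left_cancel₀ (d1_ne_zero 0) (hB.symm.trans hA)⟩

theorem eq_zero_of_comb_eq_zero {A : Fin 6 → MvPolynomial (Fin 5) ℂ} (hA : comb A = 0) :
    A = 0 := by
  have hpow : ∀ (n : ℕ) (A : Fin 6 → MvPolynomial (Fin 5) ℂ), comb A = 0 →
      ∀ j, X 0 ^ n ∣ A j := by
    intro n
    induction n with
    | zero => simp
    | succ n ih =>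
      intro A hA j
      obtain ⟨B, hAB, hB⟩ := exists_comb_eq_d1_mul (A := A) fun x _ => by rw [hA, map_zero]
      have hB0 : comb B = 0 :=
        (mul_eq_zero.1 (hB.symm.trans hA)).resolve_left (d1_ne_zero 0)
      rw [hAB, pow_succ']
      exact mul_dvd_mul_left _ (ih B hB0 j)
  funext j
  by_contra hj
  -- A nonzero `A j` is not divisible by a power of `X 0` exceeding its degree.
  obtain ⟨B, hB⟩ := hpow ((A j).totalDegree + 1) A hA j
  have hB0 : B ≠ 0 := by rintro rfl; exact hj (by simpa using hB)
  have := totalDegree_mul_of_isDomain (pow_ne_zero ((A j).totalDegree + 1)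
    (X_ne_zero (R := ℂ) (0 : Fin 5))) hB0
  rw [← hB, totalDegree_X_pow] at this
  omega

theorem comb_injective : Function.Injective comb := fun A B h =>
  sub_eq_zero.1 (eq_zero_of_comb_eq_zero (by rw [comb_sub, h, sub_self]))

/-! ### Invariance of the generators -/

theorem mem_invariantAlgebra_of_mem_invariantsOfWeight {m : ℕ} {P : JetPoly 4 2}
    (hP : P ∈ invariantsOfWeight 4 2 m) : P ∈ invariantAlgebra 4 2 :=
  Submodule.mem_iSup_of_mem (p := invariantsOfWeight 4 2) m hP

theorem d1_mem (i : Fin 2) : d1 i ∈ invariantAlgebra 4 2 := by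
  refine mem_invariantAlgebra_of_mem_invariantsOfWeight (m := 1)
    (mem_invariantsOfWeight_iff.2 ?_)
  intro c x _
  simp [d1, reparam]; ring

theorem Λ3_mem : Λ3 ∈ invariantAlgebra 4 2 := by
  refine mem_invariantAlgebra_of_mem_invariantsOfWeight (m := 3)
    (mem_invariantsOfWeight_iff.2 ?_)
  intro c x _
  simp [Λ3, Δ_eq, d1, d2, reparam]; ring

theorem Λ5_mem (i : Fin 2) : Λ5 i ∈ invariantAlgebra 4 2 := by
  refine mem_invariantAlgebra_of_mem_invariantsOfWeight (m := 5)
    (mem_invariantsOfWeight_iff.2 ?_)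
  intro c x _
  simp [Λ5, Δ_eq, d1, d2, d3, reparam]; ring

theorem Λ7_mem (i j : Fin 2) : Λ7 i j ∈ invariantAlgebra 4 2 := by
  refine mem_invariantAlgebra_of_mem_invariantsOfWeight (m := 7)
    (mem_invariantsOfWeight_iff.2 ?_)
  intro c x _
  simp [Λ7, Δ_eq, d1, d2, d3, d4, reparam]; ring

theorem M8_mem : M8 ∈ invariantAlgebra 4 2 := by
  refine mem_invariantAlgebra_of_mem_invariantsOfWeight (m := 8)
    (mem_invariantsOfWeight_iff.2 ?_)
  intro c x _
  simp [M8, Δ_eq, d1, d2, d3, d4, reparam]; ring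

theorem subst_mem (A : MvPolynomial (Fin 5) ℂ) : subst A ∈ invariantAlgebra 4 2 := by
  induction A using MvPolynomial.induction_on with
  | C c => rw [subst_C]; exact Subalgebra.algebraMap_mem _ c
  | add p q hp hq => rw [subst_add]; exact add_mem hp hq
  | mul_X p i hp =>
    rw [subst_mul, subst_X]
    refine mul_mem hp ?_
    fin_cases i
    exacts [d1_mem 0, d1_mem 1, Λ7_mem 0 0, Λ7_mem 1 1, M8_mem]

theorem comb_mem_invariantAlgebra (A : Fin 6 → MvPolynomial (Fin 5) ℂ) :
    comb A ∈ invariantAlgebra 4 2 := by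
  refine add_mem (add_mem (add_mem (add_mem (add_mem ?_ ?_) ?_) ?_) ?_) ?_
  exacts [subst_mem _, mul_mem Λ3_mem (subst_mem _), mul_mem (Λ5_mem 0) (subst_mem _),
    mul_mem (Λ5_mem 1) (subst_mem _), mul_mem (Λ7_mem 0 1) (subst_mem _),
    mul_mem (mul_mem Λ3_mem (Λ7_mem 0 1)) (subst_mem _)]

/-! ### Normal form and generation -/

/-- The jet in the orbit of `x` whose first component is linear. -/
noncomputable def normalForm (x : Fin 2 × Fin 4 → ℂ) : Fin 2 × Fin 4 → ℂ :=
  fun p => ![![x (0, 0), 0, 0, 0], ![x (1, 0), eval x Λ3 / x (0, 0),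
    eval x (Λ5 0) / x (0, 0) ^ 2, eval x (Λ7 0 0) / x (0, 0) ^ 3]] p.1 p.2

theorem exists_reparam_eq_normalForm {x : Fin 2 × Fin 4 → ℂ} (hx : x (0, 0) ≠ 0) :
    ∃ c, c 0 = 1 ∧ reparam c x = normalForm x := by
  -- The numbers `c1`, `c2`, `c3` successively cancel `f₁''`, `f₁'''`, `f₁''''`.
  obtain ⟨c1, h1⟩ : ∃ c1, c1 = -x (0, 1) / x (0, 0) := ⟨_, rfl⟩
  obtain ⟨c2, h2⟩ : ∃ c2, c2 = -(x (0, 2) + 3 * x (0, 1) * c1) / x (0, 0) := ⟨_, rfl⟩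
  obtain ⟨c3, h3⟩ : ∃ c3, c3 = -(x (0, 3) + 6 * x (0, 2) * c1
    + x (0, 1) * (3 * c1 ^ 2 + 4 * c2)) / x (0, 0) := ⟨_, rfl⟩
  refine ⟨![1, c1, c2, c3], rfl, ?_⟩
  ext ⟨i, k⟩
  fin_cases i <;> fin_cases k <;>
    simp [reparam, normalForm, h3, h2, h1, Λ3, Λ5, Λ7, Δ_eq, d1, d2, d3, d4] <;>
    field_simp <;> ring

theorem exists_eval_normalForm_mul_pow (P : JetPoly 4 2) :
    ∃ k : ℕ, ∃ w ∈ combSpan, ∀ x : Fin 2 × Fin 4 → ℂ, x (0, 0) ≠ 0 →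
      eval (normalForm x) P * x (0, 0) ^ k = eval x w := by
  induction P using MvPolynomial.induction_on with
  | C c => exact ⟨0, C c, C_mem c, fun x _ => by simp⟩
  | add p q hp hq =>
    obtain ⟨k, w, hw, h⟩ := hp
    obtain ⟨l, w', hw', h'⟩ := hq
    have hd : ∀ n, ∀ v ∈ combSpan, d1 0 ^ n * v ∈ combSpan := by
      intro n v hv
      simpa [subst, d1] using subst_mul_mem hv (X 0 ^ n)
    refine ⟨k + l, d1 0 ^ l * w + d1 0 ^ k * w', add_mem (hd l w hw) (hd k w' hw'), ?_⟩
    intro x hx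
    simp only [map_add, map_mul, map_pow, ← h x hx, ← h' x hx, d1, eval_X]
    ring
  | mul_X p i hp =>
    obtain ⟨k, w, hw, h⟩ := hp
    obtain ⟨n, y, hy, hyx⟩ : ∃ n : ℕ, ∃ y : JetPoly 4 2, y * w ∈ combSpan ∧
        ∀ x : Fin 2 × Fin 4 → ℂ, x (0, 0) ≠ 0 →
          normalForm x i * x (0, 0) ^ n = eval x y := by
      obtain ⟨i, j⟩ := i
      fin_cases i <;> fin_cases j
      · exact ⟨0, d1 0, d1_mul_mem hw 0, fun x hx => by simp [normalForm, d1]⟩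
      · exact ⟨0, 0, by simp, fun x hx => by simp [normalForm]⟩
      · exact ⟨0, 0, by simp, fun x hx => by simp [normalForm]⟩
      · exact ⟨0, 0, by simp, fun x hx => by simp [normalForm]⟩
      · exact ⟨0, d1 1, d1_mul_mem hw 1, fun x hx => by simp [normalForm, d1]⟩
      · exact ⟨1, Λ3, Λ3_mul_mem hw, fun x hx => by simp [normalForm, hx]⟩
      · exact ⟨2, Λ5 0, Λ5_mul_mem hw, fun x hx => by simp [normalForm, hx]⟩
      · exact ⟨3, Λ7 0 0, Λ7_mul_mem hw, fun x hx => by simp [normalForm, hx]⟩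
    refine ⟨k + n, y * w, hy, fun x hx => ?_⟩
    rw [map_mul, map_mul, eval_X, ← h x hx, ← hyx x hx]
    ring

theorem exists_d1_pow_mul_mem {m : ℕ} {P : JetPoly 4 2} (hP : P ∈ invariantsOfWeight 4 2 m) :
    ∃ k : ℕ, d1 0 ^ k * P ∈ combSpan := by
  obtain ⟨k, w, hw, h⟩ := exists_eval_normalForm_mul_pow P
  refine ⟨k, ?_⟩
  -- The extra factor `f₁'` makes the identity trivial where `f₁' = 0`, where no normal form is
  -- available.
  suffices d1 0 * (d1 0 ^ k * P) = d1 0 * w by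
    rwa [mul_left_cancel₀ (X_ne_zero _) this]
  refine MvPolynomial.funext fun x => ?_
  by_cases hx : x (0, 0) = 0
  · simp [d1, hx]
  · obtain ⟨c, hc, hcx⟩ := exists_reparam_eq_normalForm hx
    have h1 := mem_invariantsOfWeight_iff.1 hP c x (by simp [hc])
    rw [hcx, hc, one_pow, one_mul] at h1
    rw [map_mul, map_mul, map_mul, ← h x hx, h1, map_pow, d1, eval_X]
    ring

theorem mem_combSpan_of_mem_invariantAlgebra {P : JetPoly 4 2}
    (hP : P ∈ invariantAlgebra 4 2) : P ∈ combSpan := by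
  replace hP : P ∈ ⨆ m : ℕ, invariantsOfWeight 4 2 m := hP
  induction hP using Submodule.iSup_induction' with
  | mem m P hm =>
    obtain ⟨k, hk⟩ := exists_d1_pow_mul_mem hm
    induction k with
    | zero => simpa using hk
    | succ k ih =>
      rw [pow_succ', mul_assoc] at hk
      exact ih (mem_combSpan_of_d1_mul_mem hk)
  | zero => exact zero_mem _
  | add P Q _ _ h₁ h₂ => exact add_mem h₁ h₂

end DemaillySemple

theorem mainTheorem12 :
    (∀ Q R S T U V : MvPolynomial (Fin 5) ℂ,
      DemaillySemple.subst Q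
        + DemaillySemple.Λ3 * DemaillySemple.subst R
        + DemaillySemple.Λ5 0 * DemaillySemple.subst S
        + DemaillySemple.Λ5 1 * DemaillySemple.subst T
        + DemaillySemple.Λ7 0 1 * DemaillySemple.subst U
        + DemaillySemple.Λ3 * DemaillySemple.Λ7 0 1 * DemaillySemple.subst V
          ∈ DemaillySemple.invariantAlgebra 4 2) ∧
    ∀ P ∈ DemaillySemple.invariantAlgebra 4 2,
      ∃! A : Fin 6 → MvPolynomial (Fin 5) ℂ,
        P = DemaillySemple.subst (A 0)
          + DemaillySemple.Λ3 * DemaillySemple.subst (A 1)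
          + DemaillySemple.Λ5 0 * DemaillySemple.subst (A 2)
          + DemaillySemple.Λ5 1 * DemaillySemple.subst (A 3)
          + DemaillySemple.Λ7 0 1 * DemaillySemple.subst (A 4)
          + DemaillySemple.Λ3 * DemaillySemple.Λ7 0 1 * DemaillySemple.subst (A 5) := by
  refine ⟨fun Q R S T U V =>
    DemaillySemple.comb_mem_invariantAlgebra ![Q, R, S, T, U, V], fun P hP => ?_⟩
  obtain ⟨A, hA⟩ := DemaillySemple.mem_combSpan_of_mem_invariantAlgebra hP
  exact ⟨A, hA.symm, fun B hB => DemaillySemple.comb_injective (hB.symm.trans hA.symm)⟩
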